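/- All graphs are finite and simple. A pebbling configuration on a graph $G$ places a non-negative integer number of pebbles on each vertex. A pebbling step removes two pebbles from some vertex and places one pebble on a neighbour of it. A configuration is solvable if for every vertex $r$ there is a (possibly empty) sequence of pebbling steps after which $r$ carries at least one pebble. The pebbling number $\pi(G)$ is the least $m$ such that every configuration of $m$ pebbles on $G$ is solvable. A graph $G$ on $n$ vertices is of Class 0 if $\pi(G)=n$. The girth of a graph containing a cycle is the length of its shortest cycle. Let $g_0(n)$ be the maximum $g$ such that there is a Class 0 graph on $n$ vertices that contains a cycle and has girth at least $g$. Theorem 1. There are an integer $n_0$ and a real constant $c>0$ such that for every $n\ge n_0$ there is a Class 0 graph on $n$ vertices that contains a cycle and has girth at least $c\sqrt{\log_2 n}$; in other words, $g_0(n)\ge c\sqrt{\log_2 n}$ for every $n\ge n_0$. Consequently, Hurlbert's question has a negative answer: there is no constant $C$ such that every connected graph $G$ on $n$ vertices (for any $n$) that contains a cycle and has girth greater than $C$ satisfies $\pi(G)>n$. -/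

import Mathlib

namespace Pebbling

/-- One pebbling step from the configuration `C` to the configuration `D`: two pebbles are taken
from a vertex `u`, and one of them is put on a neighbour `v` of `u`; the other is discarded. -/
def Step {V : Type*} (G : SimpleGraph V) (C D : V → ℕ) : Prop :=
  ∃ u v : V, G.Adj u v ∧ C u = D u + 2 ∧ D v = C v + 1 ∧ ∀ w : V, w ≠ u → w ≠ v → D w = C w

/-- The configuration `C` is `r`-solvable: some (possibly empty) sequence of pebbling steps
puts a pebble on the root `r`. -/
def SolvableAt {V : Type*} (G : SimpleGraph V) (r : V) (C : V → ℕ) : Prop :=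
  ∃ D : V → ℕ, Relation.ReflTransGen (Step G) C D ∧ 1 ≤ D r

/-- The configuration `C` is solvable: it is `r`-solvable for every root `r`. -/
def Solvable {V : Type*} (G : SimpleGraph V) (C : V → ℕ) : Prop :=
  ∀ r : V, SolvableAt G r C

/-- The pebbling number: the least `m` such that every configuration of `m` pebbles is solvable.
Such an `m` exists for every connected finite graph; if there is none, the value is `0`, which is
never the number of vertices of a nonempty graph. -/
noncomputable def pebblingNumber {V : Type*} [Fintype V] (G : SimpleGraph V) : ℕ :=
  sInf {m : ℕ | ∀ C : V → ℕ, ∑ v, C v = m → Solvable G C}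

/-- A graph is of Class 0 if its pebbling number is its number of vertices. -/
def ClassZero {V : Type*} [Fintype V] (G : SimpleGraph V) : Prop :=
  pebblingNumber G = Fintype.card V

/-- `g₀(n)`: the maximum `g` such that some Class 0 graph on `n` vertices has girth at least `g`.
The girth here is `0` for acyclic graphs, so they contribute nothing to the maximum; the set is
nonempty for `n ≥ 1` and always bounded, there being finitely many graphs on `n` vertices. -/
noncomputable def maxClassZeroGirth (n : ℕ) : ℕ :=
  sSup {g : ℕ | ∃ G : SimpleGraph (Fin n), g ≤ G.girth ∧ ClassZero G}

end Pebbling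

namespace Pebbling

/-! A strong expander is of Class 0, and expansion is compatible with girth of order √log n. Suppose
n pebbles cannot reach r. With diameter at most d, no vertex ever carries q = 2^d pebbles. Let Z be
the empty vertices and I those with at least two pebbles; counting pebbles gives |Z| ≤ q|I|. A cell
is a connected set that avoids Z and contains some x in I. It can send one pebble to any outside
neighbour, because two pebbles travel through singly occupied vertices without loss. So q disjoint
cells next to one vertex w would put q pebbles on w, a contradiction.

Such cells exist (`exists_family_crowded`). Starting from singletons, either the cells are so large
in total that their neighbourhoods overlap more than q-fold, or half of them grow by a factor q. The
second case cannot occur J times when q^J > n. This needs I large, which holds because Z separates r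
from all cells (`le_card_of_separates`).

The expander (`exists_expands_le_egirth`) is built edge by edge, joining only distant vertices of
moderate degree. The random choice of endpoints is derandomised by conditional expectations. Degrees
are 2^O(g), so balls of radius g fit into n = 2^Θ(g²) vertices. -/

open Relation

/-- A set of vertices obtained from `{x}` by adding neighbours one at a time. -/
inductive GrownFrom {V : Type*} [DecidableEq V] (G : SimpleGraph V) (x : V) : Finset V → Prop
  | base : GrownFrom G x {x}
  | grow {K : Finset V} {u v : V} (h : GrownFrom G x K) (hu : u ∈ K) (hv : v ∉ K)
      (huv : G.Adj u v) : GrownFrom G x (insert v K)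

/-! ### Moving pebbles along paths and out of cells -/

section Moves

variable {V : Type*} [DecidableEq V] {G : SimpleGraph V} {C : V → ℕ}

theorem exists_step {u v : V} (h : G.Adj u v) (hu : 2 ≤ C u) :
    ∃ D, Step G C D ∧ D u = C u - 2 ∧ D v = C v + 1 ∧ ∀ w, w ≠ u → w ≠ v → D w = C w := by
  have hne : v ≠ u := h.ne'
  refine ⟨fun w => if w = u then C u - 2 else if w = v then C v + 1 else C w,
    ⟨u, v, h, ?_, ?_, ?_⟩, ?_, ?_, ?_⟩
  · simp only [if_true]; omega
  · simp [hne]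
  · intro w h1 h2; simp [h1, h2]
  · simp
  · simp [hne]
  · intro w h1 h2; simp [h1, h2]

/-- Induction along the growth: two pebbles gathered at the parent become one on the new vertex,
which still has its own pebble, since everything outside the earlier set is untouched. -/
theorem GrownFrom.exists_two_le {x : V} {K : Finset V} (hK : GrownFrom G x K) (hx : 2 ≤ C x)
    (h1 : ∀ v ∈ K, 1 ≤ C v) {u : V} (hu : u ∈ K) :
    ∃ D, ReflTransGen (Step G) C D ∧ 2 ≤ D u ∧ ∀ w, w ∉ K → D w = C w := by
  induction hK generalizing u with
  | base =>
    rw [Finset.mem_singleton] at hu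
    subst hu
    exact ⟨C, .refl, hx, fun _ _ => rfl⟩
  | @grow K p v _ hp hv hpv ih =>
    have h1' : ∀ w ∈ K, 1 ≤ C w := fun w hw => h1 w (Finset.mem_insert_of_mem hw)
    rcases Finset.mem_insert.1 hu with rfl | hu
    · obtain ⟨D, hD, hDp, hDo⟩ := ih h1' hp
      obtain ⟨E, hE, -, hEv, hEo⟩ := exists_step hpv hDp
      refine ⟨E, hD.tail hE, ?_, fun w hw => ?_⟩
      · have := h1 u (Finset.mem_insert_self _ _)
        rw [hEv, hDo u hv]; omega
      · rw [Finset.mem_insert, not_or] at hw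
        rw [hEo w (fun h => hw.2 (h ▸ hp)) hw.1, hDo w hw.2]
    · obtain ⟨D, hD, hDp, hDo⟩ := ih h1' hu
      exact ⟨D, hD, hDp, fun w hw => hDo w fun h => hw (Finset.mem_insert_of_mem h)⟩

theorem GrownFrom.exists_deliver {x : V} {K : Finset V} (hK : GrownFrom G x K) (hx : 2 ≤ C x)
    (h1 : ∀ v ∈ K, 1 ≤ C v) {u w : V} (hu : u ∈ K) (hw : w ∉ K) (huw : G.Adj u w) :
    ∃ D, ReflTransGen (Step G) C D ∧ D w = C w + 1 ∧ ∀ v, v ∉ K → v ≠ w → D v = C v := by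
  obtain ⟨D, hD, hDu, hDo⟩ := hK.exists_two_le hx h1 hu
  obtain ⟨E, hE, -, hEv, hEo⟩ := exists_step huw hDu
  refine ⟨E, hD.tail hE, by rw [hEv, hDo w hw], fun v hv hvw => ?_⟩
  rw [hEo v (fun h => hv (h ▸ hu)) hvw, hDo v hv]

theorem GrownFrom.self_mem {x : V} {K : Finset V} (hK : GrownFrom G x K) : x ∈ K := by
  induction hK with
  | base => simp
  | grow _ _ _ _ ih => exact Finset.mem_insert_of_mem ih

/-- Disjoint cells next to `w`, each with a vertex carrying two pebbles, send one pebble each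
to `w`. -/
theorem exists_deliver_many {w : V} {K : V → Finset V} (F : Finset V)
    (hdisj : (F : Set V).PairwiseDisjoint K)
    (hK : ∀ x ∈ F, GrownFrom G x (K x)) (hx : ∀ x ∈ F, 2 ≤ C x)
    (h1 : ∀ x ∈ F, ∀ v ∈ K x, 1 ≤ C v) (hw : ∀ x ∈ F, w ∉ K x)
    (hadj : ∀ x ∈ F, ∃ u ∈ K x, G.Adj u w) :
    ∃ D, ReflTransGen (Step G) C D ∧ D w = C w + F.card ∧
      ∀ v, v ≠ w → (∀ x ∈ F, v ∉ K x) → D v = C v := by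
  induction F using Finset.induction_on with
  | empty => exact ⟨C, .refl, by simp, fun _ _ _ => rfl⟩
  | @insert a F ha ih =>
    have hsub : ∀ x ∈ F, x ∈ insert a F := fun x hx => Finset.mem_insert_of_mem hx
    have haa : a ∈ insert a F := Finset.mem_insert_self _ _
    obtain ⟨D, hD, hDw, hDo⟩ := ih (hdisj.subset (by simp)) (fun x h => hK x (hsub x h))
      (fun x h => hx x (hsub x h)) (fun x h => h1 x (hsub x h)) (fun x h => hw x (hsub x h))
      (fun x h => hadj x (hsub x h))
    have hDa : ∀ v ∈ K a, D v = C v := by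
      intro v hv
      refine hDo v (fun h => hw a haa (h ▸ hv)) fun x hxF hvx => ?_
      have hne : a ≠ x := fun h => ha (h ▸ hxF)
      exact Finset.disjoint_left.1 (hdisj (by simp) (by simp [hxF]) hne) hv hvx
    obtain ⟨u, hu, huw⟩ := hadj a haa
    obtain ⟨E, hE, hEw, hEo⟩ := (hK a haa).exists_deliver (C := D)
      (by rw [hDa a (hK a haa).self_mem]; exact hx a haa)
      (fun v hv => by rw [hDa v hv]; exact h1 a haa v hv) hu (hw a haa) huw
    refine ⟨E, hD.trans hE, ?_, fun v hvw hv => ?_⟩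
    · rw [hEw, hDw, Finset.card_insert_of_notMem ha]; ring
    · rw [hEo v (hv a haa) hvw, hDo v hvw fun x h => hv x (hsub x h)]

theorem exists_move_half {u v : V} (h : G.Adj u v) (m : ℕ) (C : V → ℕ) (hu : 2 * m ≤ C u) :
    ∃ D, ReflTransGen (Step G) C D ∧ C v + m ≤ D v := by
  induction m generalizing C with
  | zero => exact ⟨C, .refl, by simp⟩
  | succ m ih =>
    obtain ⟨E, hE, hEu, hEv, -⟩ := exists_step (C := C) h (by omega)
    obtain ⟨D, hD, hDv⟩ := ih E (by omega)
    exact ⟨D, hD.head hE, by omega⟩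

/-- Each edge of the walk halves the supply. This is the source of the threshold `2 ^ d` below. -/
theorem solvableAt_of_walk {u r : V} (p : G.Walk u r) (C : V → ℕ) (hC : 2 ^ p.length ≤ C u) :
    SolvableAt G r C := by
  induction p generalizing C with
  | nil => exact ⟨C, .refl, by simpa using hC⟩
  | cons h p ih =>
    rw [SimpleGraph.Walk.length_cons, pow_succ] at hC
    obtain ⟨D, hD, hDv⟩ := exists_move_half h (2 ^ p.length) C (by omega)
    obtain ⟨E, hE, hEr⟩ := ih D (by omega)
    exact ⟨E, hD.trans hE, hEr⟩

omit [DecidableEq V] in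
theorem SolvableAt.of_reachable {r : V} {D : V → ℕ} (hCD : ReflTransGen (Step G) C D)
    (h : SolvableAt G r D) : SolvableAt G r C := by
  obtain ⟨E, hE, hEr⟩ := h
  exact ⟨E, hCD.trans hE, hEr⟩

end Moves

/-! ### Growing disjoint cells in an expander -/

section Cells

variable {V : Type*} [Fintype V] [DecidableEq V] {G : SimpleGraph V}

open Classical in
/-- The vertices with a neighbour in `A`. -/
noncomputable def nbrs (G : SimpleGraph V) (A : Finset V) : Finset V :=
  Finset.univ.filter fun v => ∃ u ∈ A, G.Adj u v

omit [DecidableEq V] in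
theorem mem_nbrs {A : Finset V} {v : V} : v ∈ nbrs G A ↔ ∃ u ∈ A, G.Adj u v := by
  simp [nbrs]

/-- Every nonempty set has more than `D` times its size, or more than three quarters of all
vertices, as neighbours. -/
def Expands (G : SimpleGraph V) (D : ℕ) : Prop :=
  ∀ A : Finset V, A.Nonempty →
    D * A.card < (nbrs G A).card ∨ 3 * Fintype.card V < 4 * (nbrs G A).card

/-- Disjoint cells `K x`, for `x ∈ F ⊆ I`, each grown from `x` and avoiding `Z`. -/
structure IsCellFamily (G : SimpleGraph V) (I Z F : Finset V) (K : V → Finset V) : Prop where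
  subset : F ⊆ I
  disj : (F : Set V).PairwiseDisjoint K
  grown : ∀ x ∈ F, GrownFrom G x (K x)
  avoid : ∀ x ∈ F, Disjoint (K x) Z

variable {I Z F : Finset V} {K : V → Finset V} {D B q s t : ℕ}

omit [Fintype V] in
theorem IsCellFamily.mono (h : IsCellFamily G I Z F K) {F' : Finset V} (hF : F' ⊆ F) :
    IsCellFamily G I Z F' K :=
  ⟨hF.trans h.subset, h.disj.subset (by exact_mod_cast hF), fun x hx => h.grown x (hF hx),
    fun x hx => h.avoid x (hF hx)⟩

omit [Fintype V] in
theorem IsCellFamily.update (h : IsCellFamily G I Z F K) {a u v : V} (ha : a ∈ F)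
    (hu : u ∈ K a) (huv : G.Adj u v) (hvZ : v ∉ Z) (hv : ∀ x ∈ F, v ∉ K x) :
    IsCellFamily G I Z F (Function.update K a (insert v (K a))) := by
  refine ⟨h.subset, ?_, ?_, ?_⟩
  · intro x hx y hy hxy
    have hd := h.disj hx hy hxy
    simp only [Function.onFun] at hd ⊢
    by_cases hxa : x = a
    · subst hxa
      rw [Function.update_self, Function.update_of_ne hxy.symm, Finset.disjoint_insert_left]
      exact ⟨hv y hy, hd⟩
    · rw [Function.update_of_ne hxa]
      by_cases hya : y = a
      · subst hya
        rw [Function.update_self, Finset.disjoint_insert_right]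
        exact ⟨hv x hx, hd⟩
      · rwa [Function.update_of_ne hya]
  · intro x hx
    by_cases hxa : x = a
    · subst hxa
      rw [Function.update_self]
      exact (h.grown x hx).grow hu (hv x hx) huv
    · rw [Function.update_of_ne hxa]
      exact h.grown x hx
  · intro x hx
    by_cases hxa : x = a
    · subst hxa
      rw [Function.update_self, Finset.disjoint_insert_left]
      exact ⟨hvZ, h.avoid x hx⟩
    · rw [Function.update_of_ne hxa]
      exact h.avoid x hx

/-- A family of cells that cannot be extended below the cap `c`: neighbours of cells below the
cap are in `Z` or in a cell. -/
theorem IsCellFamily.exists_maximal (h : IsCellFamily G I Z F K) {c : ℕ}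
    (hc : ∀ x ∈ F, (K x).card ≤ c) :
    ∃ K', IsCellFamily G I Z F K' ∧ (∀ x ∈ F, K x ⊆ K' x) ∧ (∀ x ∈ F, (K' x).card ≤ c) ∧
      ∀ x ∈ F, (K' x).card < c → nbrs G (K x) ⊆ Z ∪ F.biUnion K' := by
  classical
  -- Maximise the total size: a free neighbour of a cell below the cap could be added to it.
  obtain ⟨K', hK', hmax⟩ := Finset.exists_max_image
    (Finset.univ.filter fun K' : V → Finset V => IsCellFamily G I Z F K' ∧
      (∀ x ∈ F, K x ⊆ K' x) ∧ ∀ x ∈ F, (K' x).card ≤ c)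
    (fun K' => ∑ x ∈ F, (K' x).card)
    ⟨K, by simpa using ⟨h, hc⟩⟩
  simp only [Finset.mem_filter, Finset.mem_univ, true_and] at hK' hmax
  obtain ⟨hfam, hsub, hcap⟩ := hK'
  refine ⟨K', hfam, hsub, hcap, fun a ha hlt v hv => ?_⟩
  by_contra hv'
  simp only [Finset.mem_union, Finset.mem_biUnion, not_or, not_exists, not_and] at hv'
  obtain ⟨u, hu, huv⟩ := mem_nbrs.1 hv
  have key := hmax (Function.update K' a (insert v (K' a)))
    ⟨hfam.update ha (hsub a ha hu) huv hv'.1 hv'.2, ?_, ?_⟩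
  · refine absurd key (not_le.2 (Finset.sum_lt_sum (fun x hx => ?_) ⟨a, ha, ?_⟩))
    · by_cases hxa : x = a
      · subst hxa
        rw [Function.update_self]
        exact Finset.card_le_card (Finset.subset_insert _ _)
      · rw [Function.update_of_ne hxa]
    · rw [Function.update_self, Finset.card_insert_of_notMem (hv'.2 a ha)]
      exact Nat.lt_succ_self _
  · intro x hx
    by_cases hxa : x = a
    · subst hxa
      rw [Function.update_self]
      exact (hsub x hx).trans (Finset.subset_insert _ _)
    · rw [Function.update_of_ne hxa]
      exact hsub x hx
  · intro x hx
    by_cases hxa : x = a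
    · subst hxa
      rw [Function.update_self, Finset.card_insert_of_notMem (hv'.2 x hx)]
      exact hlt
    · rw [Function.update_of_ne hxa]
      exact hcap x hx

/-- If the cells are large in total, some vertex is next to more than `q` of them. -/
theorem IsCellFamily.exists_crowded (h : IsCellFamily G I Z F K) (hG : Expands G D)
    (hs : ∀ x ∈ F, (K x).card = s) (hs1 : 1 ≤ s) (hZ : Z.card ≤ B * F.card)
    (hD : 2 * (q + 2) * (t + B) ≤ D) (hq : 2 * (q + 2) ≤ F.card) (ht : 1 ≤ t)
    (hlarge : Fintype.card V ≤ 2 * (t * s * F.card + Z.card)) :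
    ∃ w, q < (F.filter fun x => w ∈ nbrs G (K x)).card := by
  by_contra! hcon
  -- Double counting of pairs (cell, neighbour); expansion makes the left side exceed this bound.
  have hsum : ∑ x ∈ F, (nbrs G (K x)).card ≤ q * Fintype.card V := by
    have : ∑ x ∈ F, (nbrs G (K x)).card
        = ∑ w : V, (F.filter fun x => w ∈ nbrs G (K x)).card := by
      simp only [Finset.card_eq_sum_ones, Finset.sum_filter]
      rw [Finset.sum_comm]
      refine Finset.sum_congr rfl fun x _ => ?_
      simp
    rw [this]
    calc _ ≤ ∑ _w : V, q := Finset.sum_le_sum fun w _ => hcon w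
      _ = q * Fintype.card V := by simp [mul_comm]
  have hFpos : 0 < F.card := by omega
  obtain ⟨x₀, hx₀⟩ := Finset.card_pos.1 hFpos
  have hn : 0 < Fintype.card V := Fintype.card_pos_iff.2 ⟨x₀⟩
  have hexp : ∀ x ∈ F, D * s < (nbrs G (K x)).card ∨
      3 * Fintype.card V < 4 * (nbrs G (K x)).card := by
    intro x hx
    have := hG (K x) ⟨x, (h.grown x hx).self_mem⟩
    rwa [hs x hx] at this
  -- Either every neighbourhood has at least 3n/4 vertices, and 2(q + 2) cells are already too many,
  -- or each has at least `D * s`, and `hlarge` bounds n in terms of `s * F.card`.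
  rcases le_total (3 * Fintype.card V) (4 * (D * s)) with hc | hc
  · have h1 : ∑ x ∈ F, 3 * Fintype.card V ≤ ∑ x ∈ F, 4 * (nbrs G (K x)).card :=
      Finset.sum_le_sum fun x hx => by rcases hexp x hx with h | h <;> omega
    rw [← Finset.mul_sum, ← Finset.mul_sum, Finset.sum_const, smul_eq_mul] at h1
    have h2 : 2 * (q + 2) * (3 * Fintype.card V) ≤ F.card * (3 * Fintype.card V) :=
      Nat.mul_le_mul_right _ hq
    nlinarith
  · have h1 : ∑ x ∈ F, D * s ≤ ∑ x ∈ F, (nbrs G (K x)).card :=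
      Finset.sum_le_sum fun x hx => by rcases hexp x hx with h | h <;> omega
    rw [Finset.sum_const, smul_eq_mul] at h1
    have h2 : F.card * (D * s) ≤ q * (2 * (t * s * F.card + Z.card)) :=
      h1.trans (hsum.trans (Nat.mul_le_mul_left _ hlarge))
    have h3 : Z.card ≤ B * (s * F.card) := hZ.trans (Nat.mul_le_mul_left _ (by nlinarith))
    have h4 : 2 * (q + 2) * (t + B) * (s * F.card) ≤ D * (s * F.card) :=
      Nat.mul_le_mul_right _ hD
    have h5 : 0 < t * (s * F.card) := by positivity
    have h6 : q * (2 * Z.card) ≤ q * (2 * (B * (s * F.card))) := by gcongr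
    nlinarith

/-- If the cells are small in total, at least half of them can grow by the factor `t`. -/
theorem IsCellFamily.exists_grow (h : IsCellFamily G I Z F K) (hG : Expands G D)
    (hs : ∀ x ∈ F, (K x).card = s) (hs1 : 1 ≤ s) (hZ : Z.card ≤ B * F.card)
    (hD : 2 * (t + B) ≤ D) (ht : 1 ≤ t)
    (hsmall : 2 * (t * s * F.card + Z.card) < Fintype.card V) :
    ∃ F' K', IsCellFamily G I Z F' K' ∧ (∀ x ∈ F', (K' x).card = t * s) ∧
      F.card ≤ 2 * F'.card := by
  obtain ⟨K', hK', hsub, hcap, hstuck⟩ := h.exists_maximal (c := t * s)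
    (fun x hx => by rw [hs x hx]; nlinarith)
  -- The stuck cells. Were they more than half, the union of their original parts would have all its
  -- neighbours in `Z` or in the cells, which is too few for expansion.
  set A := F.filter fun x => (K' x).card < t * s with hA
  have hAF : A ⊆ F := Finset.filter_subset _ _
  have hcard : (F \ A).card = F.card - A.card := Finset.card_sdiff_of_subset hAF
  have hAc : A.card ≤ F.card := Finset.card_le_card hAF
  refine ⟨F \ A, K', hK'.mono Finset.sdiff_subset, fun x hx => ?_, ?_⟩
  · simp only [hA, Finset.mem_sdiff, Finset.mem_filter, not_and, not_lt] at hx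
    exact le_antisymm (hcap x hx.1) (hx.2 hx.1)
  · by_contra! hlt
    have hA2 : F.card < 2 * A.card := by omega
    have hS : (A.biUnion K).card = A.card * s := by
      rw [Finset.card_biUnion fun x hx y hy hxy => h.disj (hAF hx) (hAF hy) hxy,
        Finset.sum_congr rfl fun x hx => hs x (hAF hx), Finset.sum_const, smul_eq_mul]
    have hnb : nbrs G (A.biUnion K) ⊆ Z ∪ F.biUnion K' := by
      intro v hv
      obtain ⟨u, hu, huv⟩ := mem_nbrs.1 hv
      obtain ⟨x, hx, hux⟩ := Finset.mem_biUnion.1 hu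
      exact hstuck x (hAF hx) (Finset.mem_filter.1 hx).2 (mem_nbrs.2 ⟨u, hux, huv⟩)
    have hle : (nbrs G (A.biUnion K)).card ≤ Z.card + t * s * F.card := by
      refine (Finset.card_le_card hnb).trans ((Finset.card_union_le _ _).trans ?_)
      have : (F.biUnion K').card ≤ F.card * (t * s) := Finset.card_biUnion_le_card_mul _ _ _ hcap
      rw [mul_comm (t * s)]
      omega
    have hpos : 0 < (A.biUnion K).card := by
      rw [hS]; exact Nat.mul_pos (by omega) (by omega)
    rcases hG _ (Finset.card_pos.1 hpos) with h1 | h1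
    · rw [hS] at h1
      have h3 : Z.card ≤ B * (s * F.card) := hZ.trans (Nat.mul_le_mul_left _ (by nlinarith))
      have h4 : 2 * (t + B) * (A.card * s) ≤ D * (A.card * s) := Nat.mul_le_mul_right _ hD
      have h5 : (t + B) * s * F.card ≤ (t + B) * s * (2 * A.card) := by gcongr
      nlinarith
    · omega

/-- In an expanding graph some vertex is next to more than `q` disjoint cells. -/
theorem exists_family_crowded (hG : Expands G D) {J : ℕ} (hIZ : Disjoint I Z)
    (hZ : Z.card ≤ q * I.card) (hq1 : 1 ≤ q) (hJ : Fintype.card V < q ^ J)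
    (hD : 2 * (q + 2) * (q + q * 2 ^ J) ≤ D) (hI : 2 ^ J * (2 * (q + 2)) ≤ I.card) :
    ∃ F K w, IsCellFamily G I Z F K ∧ q < (F.filter fun x => w ∈ nbrs G (K x)).card := by
  by_contra! hcon
  have key : ∀ j ≤ J, ∃ F K, IsCellFamily G I Z F K ∧ (∀ x ∈ F, (K x).card = q ^ j) ∧
      I.card ≤ 2 ^ j * F.card := by
    intro j
    induction j with
    | zero =>
      intro _
      refine ⟨I, fun x => {x}, ⟨subset_rfl, ?_, fun x _ => .base, fun x hx => ?_⟩, by simp,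
        by simp⟩
      · intro x _ y _ hxy
        simpa [Function.onFun] using hxy
      · simpa using Finset.disjoint_left.1 hIZ hx
    | succ j ih =>
      intro hj
      obtain ⟨F, K, hF, hs, hm⟩ := ih (by omega)
      have h2 : 2 ^ j ≤ 2 ^ J := Nat.pow_le_pow_right (by norm_num) (by omega)
      have hFc : 2 * (q + 2) ≤ F.card := by
        by_contra! hlt
        have : 2 ^ j * F.card < 2 ^ J * (2 * (q + 2)) :=
          lt_of_le_of_lt (Nat.mul_le_mul_right _ h2)
            (Nat.mul_lt_mul_of_pos_left hlt (by positivity))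
        omega
      have hZF : Z.card ≤ (q * 2 ^ J) * F.card :=
        calc Z.card ≤ q * I.card := hZ
          _ ≤ q * (2 ^ j * F.card) := Nat.mul_le_mul_left _ hm
          _ ≤ q * (2 ^ J * F.card) := by gcongr
          _ = _ := by ring
      have hs1 : 1 ≤ q ^ j := Nat.one_le_pow _ _ hq1
      by_cases hl : Fintype.card V ≤ 2 * (q * q ^ j * F.card + Z.card)
      · obtain ⟨w, hw⟩ := hF.exists_crowded hG hs hs1 hZF hD hFc hq1 hl
        exact absurd hw (not_lt.2 (hcon F K w hF))
      · obtain ⟨F', K', hF', hs', hm'⟩ := hF.exists_grow hG hs hs1 hZF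
          (by nlinarith) hq1 (not_le.1 hl)
        refine ⟨F', K', hF', fun x hx => by rw [hs' x hx, pow_succ, mul_comm], ?_⟩
        calc I.card ≤ 2 ^ j * F.card := hm
          _ ≤ 2 ^ j * (2 * F'.card) := Nat.mul_le_mul_left _ hm'
          _ = _ := by ring
  -- After `J` rounds a surviving cell would have `q ^ J` vertices, more than the graph.
  obtain ⟨F, K, hF, hs, hm⟩ := key J le_rfl
  have hIpos : 0 < I.card := lt_of_lt_of_le (by positivity) hI
  have hFpos : 0 < F.card := by
    by_contra! h0
    have : F.card = 0 := by omega
    rw [this] at hm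
    omega
  obtain ⟨x, hx⟩ := Finset.card_pos.1 hFpos
  have := hs x hx
  have h2 := Finset.card_le_univ (K x)
  omega

/-- Few vertices can separate `r` from a large set in an expanding graph. -/
theorem le_card_of_separates (hG : Expands G D) {R Z : Finset V} {r : V}
    (hD : q + 1 ≤ D) (hDn : 4 * D ≤ Fintype.card V) (hR : R.Nonempty)
    (hZR : Z.card ≤ q * R.card) (hRZ : Disjoint R Z) (hrZ : r ∈ Z)
    (hnb : nbrs G R ⊆ R ∪ Z) (hr : r ∉ nbrs G R) : D ≤ Z.card := by
  have h1 : (nbrs G R).card ≤ R.card + Z.card :=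
    (Finset.card_le_card hnb).trans (Finset.card_union_le _ _)
  have h2 : 3 * Fintype.card V < 4 * (R.card + Z.card) := by
    rcases hG R hR with h | h
    · have : (q + 1) * R.card ≤ D * R.card := Nat.mul_le_mul_right _ hD
      nlinarith
    · omega
  -- The far side of the separator, nonempty because of `r`. If it expands by the factor `D`, the
  -- excess lies in `Z`. Otherwise both sides have over 3n/4 vertices once `Z` is added, so |Z| >
  -- n/4.
  set T : Finset V := insert r (R ∪ Z)ᶜ with hT
  have hTR : Disjoint T R := by
    rw [hT, Finset.disjoint_insert_left]
    refine ⟨fun h => Finset.disjoint_left.1 hRZ h hrZ, ?_⟩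
    exact Finset.disjoint_left.2 fun x hx hxR =>
      (Finset.mem_compl.1 hx) (Finset.mem_union_left _ hxR)
  have hTnb : nbrs G T ⊆ T ∪ Z := by
    intro v hv
    obtain ⟨u, hu, huv⟩ := mem_nbrs.1 hv
    by_contra hv'
    simp only [hT, Finset.mem_union, Finset.mem_insert, Finset.mem_compl, not_or, not_and,
      not_not] at hv'
    have hvR : v ∈ R := by tauto
    have hu' : u ∈ nbrs G R := mem_nbrs.2 ⟨v, hvR, huv.symm⟩
    rcases Finset.mem_insert.1 hu with rfl | hu
    · exact hr hu'
    · exact Finset.mem_compl.1 hu (hnb hu')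
  have h3 : (nbrs G T).card ≤ T.card + Z.card :=
    (Finset.card_le_card hTnb).trans (Finset.card_union_le _ _)
  have h4 : T.card + R.card ≤ Fintype.card V := by
    rw [← Finset.card_union_of_disjoint hTR]
    exact Finset.card_le_univ _
  have hTne : T.Nonempty := ⟨r, Finset.mem_insert_self _ _⟩
  rcases hG T hTne with h | h
  · have hT1 : 1 ≤ T.card := Finset.card_pos.2 hTne
    by_contra! hlt
    nlinarith
  · omega

end Cells

/-! ### Strong expanders solve every configuration of n pebbles -/

section Solving

variable {V : Type*} [Fintype V] [DecidableEq V] {G : SimpleGraph V} {D d J : ℕ}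

theorem solvable_of_expands (hG : Expands G D)
    (hdiam : ∀ u v : V, ∃ p : G.Walk u v, p.length ≤ d)
    (hJ : Fintype.card V < (2 ^ d) ^ J)
    (hD : 2 * (2 ^ d + 2) * (2 ^ d + 2 ^ d * 2 ^ J) ≤ D) (hDn : 4 * D ≤ Fintype.card V)
    (C : V → ℕ) (hC : ∑ v, C v = Fintype.card V) : Solvable G C := by
  intro r
  by_contra hns
  set q := 2 ^ d with hq
  have hq1 : 1 ≤ q := Nat.one_le_two_pow
  have hCr : C r = 0 := by
    by_contra h
    exact hns ⟨C, .refl, by omega⟩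
  have hbound : ∀ E, ReflTransGen (Step G) C E → ∀ v, E v < q := by
    intro E hE v
    by_contra! hv
    obtain ⟨p, hp⟩ := hdiam v r
    exact hns ((solvableAt_of_walk p E
      ((Nat.pow_le_pow_right (by norm_num) hp).trans hv)).of_reachable hE)
  set Z := Finset.univ.filter fun v => C v = 0 with hZdef
  set I := Finset.univ.filter fun v => 2 ≤ C v with hIdef
  have hrZ : r ∈ Z := by simp [hZdef, hCr]
  have hIZ : Disjoint I Z := by
    rw [Finset.disjoint_filter]
    intro v _ h1 h2
    omega
  -- The average is one pebble per vertex, so each empty vertex is paid for by a surplus, and a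
  -- vertex of `I` has a surplus below `q`.
  have hZI : Z.card ≤ q * I.card := by
    have h1 : ∑ v, (C v + if C v = 0 then 1 else 0) ≤ ∑ v, (1 + if 2 ≤ C v then q else 0) := by
      refine Finset.sum_le_sum fun v _ => ?_
      have := hbound C .refl v
      split_ifs <;> omega
    rw [Finset.sum_add_distrib, Finset.sum_add_distrib, hC, ← Finset.sum_filter,
      ← Finset.sum_filter, ← hZdef, ← hIdef] at h1
    simp only [Finset.sum_const, smul_eq_mul, mul_one, Finset.card_univ] at h1
    rw [mul_comm]
    omega
  have hcell : ∀ x K, x ∈ I → GrownFrom G x K → Disjoint K Z → ∀ v ∈ K, 1 ≤ C v := by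
    intro x K _ _ hKZ v hv
    have := Finset.disjoint_left.1 hKZ hv
    simp only [hZdef, Finset.mem_filter, Finset.mem_univ, true_and] at this
    omega
  have hI2 : ∀ x ∈ I, 2 ≤ C x := fun x hx => (Finset.mem_filter.1 hx).2
  have hqD : q + 1 ≤ D :=
    calc q + 1 ≤ 2 * (q + 2) * 1 := by omega
      _ ≤ 2 * (q + 2) * (q + q * 2 ^ J) := Nat.mul_le_mul_left _ (by omega)
      _ ≤ D := hD
  have hDZ : D ≤ Z.card := by
    classical
    -- The union of all cells. It is closed under taking neighbours outside `Z`, and `r` is not next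
    -- to it, since a cell next to `r` would send it a pebble.
    set R := Finset.univ.filter fun v => ∃ x K, x ∈ I ∧ GrownFrom G x K ∧ Disjoint K Z ∧ v ∈ K
      with hR
    have hmem : ∀ v, v ∈ R ↔ ∃ x K, x ∈ I ∧ GrownFrom G x K ∧ Disjoint K Z ∧ v ∈ K := by
      simp [hR]
    have hIR : I ⊆ R := fun x hx => (hmem x).2
      ⟨x, {x}, hx, .base, by simpa using Finset.disjoint_left.1 hIZ hx, by simp⟩
    have hZ1 : 1 ≤ Z.card := Finset.card_pos.2 ⟨r, hrZ⟩
    have hI1 : 0 < I.card := by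
      by_contra! h0
      have : I.card = 0 := by omega
      rw [this] at hZI
      omega
    have hnb : nbrs G R ⊆ R ∪ Z := by
      intro v hv
      obtain ⟨u, hu, huv⟩ := mem_nbrs.1 hv
      obtain ⟨x, K, hx, hK, hKZ, huK⟩ := (hmem u).1 hu
      by_cases hvZ : v ∈ Z
      · exact Finset.mem_union_right _ hvZ
      refine Finset.mem_union_left _ ((hmem v).2 ?_)
      by_cases hvK : v ∈ K
      · exact ⟨x, K, hx, hK, hKZ, hvK⟩
      · exact ⟨x, insert v K, hx, hK.grow huK hvK huv,
          Finset.disjoint_insert_left.2 ⟨hvZ, hKZ⟩, Finset.mem_insert_self _ _⟩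
    have hRZ : Disjoint R Z := by
      refine Finset.disjoint_left.2 fun v hv => ?_
      obtain ⟨x, K, -, -, hKZ, hvK⟩ := (hmem v).1 hv
      exact Finset.disjoint_left.1 hKZ hvK
    refine le_card_of_separates hG (q := q) hqD hDn ((Finset.card_pos.1 hI1).mono hIR)
      (hZI.trans (Nat.mul_le_mul_left _ (Finset.card_le_card hIR))) hRZ hrZ hnb fun hr => ?_
    obtain ⟨u, hu, hur⟩ := mem_nbrs.1 hr
    obtain ⟨x, K, hx, hK, hKZ, huK⟩ := (hmem u).1 hu
    obtain ⟨E, hE, hEr, -⟩ := hK.exists_deliver (hI2 x hx) (hcell x K hx hK hKZ) huK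
      (fun h => Finset.disjoint_left.1 hKZ h hrZ) hur
    exact hns ⟨E, hE, by omega⟩
  have hIbig : 2 ^ J * (2 * (q + 2)) ≤ I.card := by
    by_contra! hlt
    have h1 : q * I.card < q * (2 ^ J * (2 * (q + 2))) := Nat.mul_lt_mul_of_pos_left hlt (by omega)
    nlinarith
  obtain ⟨F, K, w, hF, hw⟩ := exists_family_crowded hG hIZ hZI hq1 hJ hD hIbig
  set F₁ := F.filter fun x => w ∈ nbrs G (K x) with hF₁
  -- At most one of the disjoint cells contains `w`, so more than `q` adjacent cells leave at least
  -- `q` that can deliver to it.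
  set F₂ := F₁.filter fun x => w ∉ K x with hF₂
  have hF₁F : F₁ ⊆ F := Finset.filter_subset _ _
  have hF₂F : F₂ ⊆ F := (Finset.filter_subset _ _).trans hF₁F
  have hone : (F₁.filter fun x => w ∈ K x).card ≤ 1 := by
    refine Finset.card_le_one.2 fun x hx y hy => ?_
    rw [Finset.mem_filter] at hx hy
    by_contra hne
    exact Finset.disjoint_left.1 (hF.disj (hF₁F hx.1) (hF₁F hy.1) hne) hx.2 hy.2
  have hsplit := Finset.card_filter_add_card_filter_not (s := F₁) (fun x => w ∈ K x)
  have hF₂c : q ≤ F₂.card := by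
    rw [hF₂]
    omega
  obtain ⟨E, hE, hEw, -⟩ := exists_deliver_many (C := C) (w := w) (K := K) (G := G) F₂
    (hF.mono hF₂F).disj (fun x hx => hF.grown x (hF₂F hx))
    (fun x hx => hI2 x (hF.subset (hF₂F hx)))
    (fun x hx => hcell x (K x) (hF.subset (hF₂F hx)) (hF.grown x (hF₂F hx))
      (hF.avoid x (hF₂F hx)))
    (fun x hx => (Finset.mem_filter.1 hx).2)
    (fun x hx => mem_nbrs.1 (Finset.mem_filter.1 (Finset.mem_filter.1 hx).1).2)
  have := hbound E hE w
  omega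

end Solving

/-! ### Adding edges with control of girth and degrees -/

section Greedy

variable {V : Type*} [DecidableEq V] {G : SimpleGraph V}

/-- Joining two vertices at distance at least `g` creates no cycle shorter than `g`. -/
theorem le_egirth_sup_edge {g : ℕ} {x v : V} (hG : (g : ℕ∞) ≤ G.egirth)
    (hxv : ∀ p : G.Walk x v, g ≤ p.length) : (g : ℕ∞) ≤ (G ⊔ SimpleGraph.edge x v).egirth := by
  have key : ∀ {a b : V} (w : (G ⊔ SimpleGraph.edge x v).Walk a b), s(x, v) ∉ w.edges →
      ∀ e ∈ w.edges, e ∈ G.edgeSet := by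
    intro a b w hw e he
    have h1 := w.edges_subset_edgeSet he
    have hne : e ≠ s(x, v) := fun h => hw (h ▸ he)
    rw [SimpleGraph.edgeSet_sup] at h1
    rcases h1 with h1 | h1
    · exact h1
    · rw [SimpleGraph.edge, SimpleGraph.edgeSet_fromEdgeSet] at h1
      exact absurd h1.1 hne
  rw [SimpleGraph.le_egirth] at hG ⊢
  intro a w hw
  by_cases he : s(x, v) ∈ w.edges
  · have hx := w.fst_mem_support_of_mem_edges he
    have hv := w.snd_mem_support_of_mem_edges he
    -- The cycle, started at `x` and cut at `v`, consists of two arcs. The new edge lies on at most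
    -- one, so the other is a walk in `G` between `x` and `v`.
    set c := w.rotate x hx with hc
    have hvc : v ∈ c.support := (SimpleGraph.Walk.mem_support_rotate_iff _ _ _).2 hv
    have hnd : c.edges.Nodup := (hw.rotate hx).edges_nodup
    have hlen : (c.takeUntil v hvc).length + (c.dropUntil v hvc).length = w.length := by
      rw [← SimpleGraph.Walk.length_append, SimpleGraph.Walk.take_spec, hc,
        SimpleGraph.Walk.length_rotate]
    rw [← c.take_spec hvc, SimpleGraph.Walk.edges_append] at hnd
    have hdisj := List.disjoint_of_nodup_append hnd
    rw [Nat.cast_le]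
    by_cases h1 : s(x, v) ∈ (c.takeUntil v hvc).edges
    · have h2 : s(x, v) ∉ (c.dropUntil v hvc).edges := fun h => hdisj h1 h
      have := hxv ((c.dropUntil v hvc).transfer G (key _ h2)).reverse
      rw [SimpleGraph.Walk.length_reverse, SimpleGraph.Walk.length_transfer] at this
      omega
    · have := hxv ((c.takeUntil v hvc).transfer G (key _ h1))
      rw [SimpleGraph.Walk.length_transfer] at this
      omega
  · have := hG a (w.transfer G (key w he)) (hw.transfer _)
    rwa [SimpleGraph.Walk.length_transfer] at this

variable [Fintype V]

/-- The vertices at distance at most `j` from `x`. -/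
noncomputable def distBall (G : SimpleGraph V) (x : V) : ℕ → Finset V
  | 0 => {x}
  | j + 1 => distBall G x j ∪ nbrs G (distBall G x j)

theorem mem_distBall_of_walk {x v : V} {j : ℕ} (p : G.Walk v x) (hp : p.length ≤ j) :
    v ∈ distBall G x j := by
  induction j generalizing v with
  | zero =>
    have := SimpleGraph.Walk.eq_of_length_eq_zero (Nat.le_zero.1 hp)
    simp [distBall, this]
  | succ j ih =>
    cases p with
    | nil => exact Finset.mem_union_left _ (ih .nil (Nat.zero_le _))
    | cons h p =>
      rw [SimpleGraph.Walk.length_cons] at hp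
      exact Finset.mem_union_right _ (mem_nbrs.2 ⟨_, ih p (by omega), h.symm⟩)

/-- The number of neighbours of `v`. -/
noncomputable def deg (G : SimpleGraph V) (v : V) : ℕ := (nbrs G {v}).card

theorem card_nbrs_le {m : ℕ} (hm : ∀ v, deg G v ≤ m) (A : Finset V) :
    (nbrs G A).card ≤ A.card * m := by
  have : nbrs G A ⊆ A.biUnion fun v => nbrs G {v} := by
    intro v hv
    obtain ⟨u, hu, huv⟩ := mem_nbrs.1 hv
    exact Finset.mem_biUnion.2 ⟨u, hu, mem_nbrs.2 ⟨u, by simp, huv⟩⟩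
  exact (Finset.card_le_card this).trans (Finset.card_biUnion_le_card_mul _ _ _ fun v _ => hm v)

theorem card_distBall_le {m : ℕ} (hm : ∀ v, deg G v ≤ m) (x : V) (j : ℕ) :
    (distBall G x j).card ≤ (m + 1) ^ j := by
  induction j with
  | zero => simp [distBall]
  | succ j ih =>
    calc (distBall G x j ∪ nbrs G (distBall G x j)).card
        ≤ (distBall G x j).card + (distBall G x j).card * m :=
          (Finset.card_union_le _ _).trans (Nat.add_le_add_left (card_nbrs_le hm _) _)
      _ = (distBall G x j).card * (m + 1) := by ring
      _ ≤ (m + 1) ^ j * (m + 1) := Nat.mul_le_mul_right _ ih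
      _ = _ := (pow_succ _ _).symm

theorem deg_sup_edge_le (x v u : V) :
    deg (G ⊔ SimpleGraph.edge x v) u
      ≤ deg G u + ((if u = x then 1 else 0) + if u = v then 1 else 0) := by
  have hsub : nbrs (G ⊔ SimpleGraph.edge x v) {u} ⊆
      nbrs G {u} ∪ ((if u = x then {v} else ∅) ∪ if u = v then {x} else ∅) := by
    intro y hy
    obtain ⟨u', hu', huy⟩ := mem_nbrs.1 hy
    rw [Finset.mem_singleton] at hu'
    subst hu'
    rw [SimpleGraph.sup_adj, SimpleGraph.edge_adj] at huy
    rcases huy with h | ⟨⟨h1, h2⟩ | ⟨h1, h2⟩, -⟩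
    · exact Finset.mem_union_left _ (mem_nbrs.2 ⟨u', by simp, h⟩)
    · subst h1; subst h2; simp
    · subst h1; subst h2; simp
  refine (Finset.card_le_card hsub).trans ((Finset.card_union_le _ _).trans ?_)
  refine Nat.add_le_add_left ((Finset.card_union_le _ _).trans ?_) _
  split_ifs <;> simp

/-! ### Conditional expectations for the expansion property -/

section Potential

variable {k : ℕ}

/-- The factor of the event `f '' (A × Fin k) ⊆ B` at `e`, conditionally on the values of `f`
on `P`. -/
def factor (ρ : ℝ) (f : V × Fin k → V) (P : Finset (V × Fin k)) (B : Finset V)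
    (e : V × Fin k) : ℝ :=
  if e ∈ P then if f e ∈ B then 1 else 0 else ρ

/-- The expected number of pairs `(A, B)` in `T` with `f '' (A × Fin k) ⊆ B`, conditionally on the
values of `f` on `P`. -/
def potential (ρ : ℝ) (T : Finset (Finset V × Finset V)) (f : V × Fin k → V)
    (P : Finset (V × Fin k)) : ℝ :=
  ∑ τ ∈ T, ∏ e ∈ τ.1 ×ˢ Finset.univ, factor ρ f P τ.2 e

variable {ρ : ℝ} {f : V × Fin k → V} {P : Finset (V × Fin k)} {T : Finset (Finset V × Finset V)}

omit [Fintype V] in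
theorem factor_nonneg (hρ : 0 ≤ ρ) (B : Finset V) (e : V × Fin k) : 0 ≤ factor ρ f P B e := by
  unfold factor
  split_ifs <;> norm_num [hρ]

omit [Fintype V] in
theorem factor_update_of_ne {B : Finset V} {e a : V × Fin k} {v : V} (h : e ≠ a) :
    factor ρ (Function.update f a v) (insert a P) B e = factor ρ f P B e := by
  simp [factor, h]

omit [Fintype V] in
/-- Some admissible value at `a` does not increase the potential. -/
theorem exists_potential_update_le (hρ : 0 ≤ ρ) {a : V × Fin k} (ha : a ∉ P) {S : Finset V}
    (hS : S.Nonempty) (hT : ∀ τ ∈ T, (τ.2.card : ℝ) ≤ ρ * S.card) :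
    ∃ v ∈ S, potential ρ T (Function.update f a v) (insert a P) ≤ potential ρ T f P := by
  refine Finset.exists_le_of_sum_le hS ?_
  unfold potential
  rw [Finset.sum_comm, Finset.sum_const, nsmul_eq_mul, Finset.mul_sum]
  refine Finset.sum_le_sum fun τ hτ => ?_
  by_cases haτ : a ∈ τ.1 ×ˢ (Finset.univ : Finset (Fin k))
  · rw [← Finset.mul_prod_erase _ _ haτ]
    set w := ∏ e ∈ (τ.1 ×ˢ (Finset.univ : Finset (Fin k))).erase a, factor ρ f P τ.2 e with hw
    have hw0 : 0 ≤ w := Finset.prod_nonneg fun e _ => factor_nonneg hρ _ _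
    have hterm : ∀ v ∈ S, (∏ e ∈ τ.1 ×ˢ (Finset.univ : Finset (Fin k)),
        factor ρ (Function.update f a v) (insert a P) τ.2 e)
          = (if v ∈ τ.2 then 1 else 0) * w := by
      intro v _
      rw [← Finset.mul_prod_erase _ _ haτ, hw]
      congr 1
      · simp [factor]
      · exact Finset.prod_congr rfl fun e he => factor_update_of_ne (Finset.ne_of_mem_erase he)
    rw [Finset.sum_congr rfl hterm, ← Finset.sum_mul, ← mul_assoc]
    refine mul_le_mul_of_nonneg_right ?_ hw0
    have h1 : (∑ v ∈ S, if v ∈ τ.2 then (1 : ℝ) else 0) ≤ τ.2.card := by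
      rw [← Finset.sum_filter, Finset.sum_const, nsmul_eq_mul, mul_one]
      exact_mod_cast Finset.card_le_card fun v hv => (Finset.mem_filter.1 hv).2
    calc _ ≤ (τ.2.card : ℝ) := h1
      _ ≤ ρ * S.card := hT τ hτ
      _ = _ := by simp [factor, ha, mul_comm]
  · have hterm : ∀ v ∈ S, (∏ e ∈ τ.1 ×ˢ (Finset.univ : Finset (Fin k)),
        factor ρ (Function.update f a v) (insert a P) τ.2 e)
          = ∏ e ∈ τ.1 ×ˢ (Finset.univ : Finset (Fin k)), factor ρ f P τ.2 e :=
      fun v _ => Finset.prod_congr rfl fun e he =>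
        factor_update_of_ne fun h => haτ (h ▸ he)
    rw [Finset.sum_congr rfl hterm, Finset.sum_const, nsmul_eq_mul]

/-- Once all values are fixed, every term is 0 or 1, so a total below 1 leaves no obstruction
realised. -/
theorem exists_notMem_of_potential_lt_one (hρ : 0 ≤ ρ)
    (h : potential ρ T f Finset.univ < 1) {τ : Finset V × Finset V} (hτ : τ ∈ T) :
    ∃ e : V × Fin k, e.1 ∈ τ.1 ∧ f e ∉ τ.2 := by
  by_contra! hcon
  refine absurd h (not_lt.2 ?_)
  have h1 : ∏ e ∈ τ.1 ×ˢ (Finset.univ : Finset (Fin k)), factor ρ f Finset.univ τ.2 e = 1 :=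
    Finset.prod_eq_one fun e he => by simp [factor, hcon e (Finset.mem_product.1 he).1]
  rw [← h1]
  exact Finset.single_le_sum (f := fun τ : Finset V × Finset V =>
    ∏ e ∈ τ.1 ×ˢ (Finset.univ : Finset (Fin k)), factor ρ f Finset.univ τ.2 e)
    (fun τ _ => Finset.prod_nonneg fun e _ => factor_nonneg hρ _ _) hτ

/-- Pairs of a nonempty set `A` and a set `B` with `min (D|A|) (3n/4)` elements. -/
def obstructions (V : Type*) [Fintype V] [DecidableEq V] (D : ℕ) :
    Finset (Finset V × Finset V) :=
  Finset.univ.filter fun τ => τ.1 ∈ Finset.univ.erase (∅ : Finset V) ∧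
    τ.2 ∈ Finset.powersetCard (min (D * τ.1.card) (3 * Fintype.card V / 4)) Finset.univ

/-- Union bound: a set `A` has at most n^(D|A|) partners, so the sum over nonempty `A` is at most (1
+ y)^n - 1, where y = n^D ρ^k. Since ny ≤ 1/2, this is below √e - 1 < 1 up to equality. -/
theorem potential_empty_lt_one {D : ℕ} (hρ : 0 ≤ ρ) (hn : 1 ≤ Fintype.card V)
    (hk : 2 * (Fintype.card V : ℝ) ^ (D + 1) * ρ ^ k ≤ 1) :
    potential ρ (obstructions V D) f ∅ < 1 := by
  set n := Fintype.card V with hndef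
  have hn' : (1 : ℝ) ≤ n := by exact_mod_cast hn
  set y : ℝ := (n : ℝ) ^ D * ρ ^ k with hy
  have hy0 : 0 ≤ y := by positivity
  have hny : n * y ≤ 1 / 2 := by
    have : 2 * (n : ℝ) ^ (D + 1) * ρ ^ k = 2 * (n * y) := by rw [hy]; ring
    linarith
  have h1 : potential ρ (obstructions V D) f ∅
      = ∑ A ∈ Finset.univ.erase (∅ : Finset V),
        ((Finset.powersetCard (min (D * A.card) (3 * n / 4)) (Finset.univ : Finset V)).card : ℝ)
          * (ρ ^ k) ^ A.card := by
    unfold potential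
    rw [Finset.sum_finset_product (obstructions V D) (Finset.univ.erase (∅ : Finset V))
      (fun A => Finset.powersetCard (min (D * A.card) (3 * n / 4)) Finset.univ)
      (fun p => by simp [obstructions, hndef])]
    refine Finset.sum_congr rfl fun A _ => ?_
    have : ∀ B : Finset V, ∏ e ∈ A ×ˢ (Finset.univ : Finset (Fin k)), factor ρ f ∅ B e
        = (ρ ^ k) ^ A.card := by
      intro B
      simp only [factor, Finset.notMem_empty, if_false, Finset.prod_const, Finset.card_product,
        Finset.card_univ, Fintype.card_fin]
      rw [← pow_mul, mul_comm]
    simp only [this, Finset.sum_const, nsmul_eq_mul]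
  have h2 : ∀ A : Finset V,
      ((Finset.powersetCard (min (D * A.card) (3 * n / 4)) (Finset.univ : Finset V)).card : ℝ)
          * (ρ ^ k) ^ A.card ≤ y ^ A.card := by
    intro A
    rw [hy, mul_pow, Finset.card_powersetCard, Finset.card_univ]
    refine mul_le_mul_of_nonneg_right ?_ (by positivity)
    rw [← pow_mul]
    calc ((n.choose (min (D * A.card) (3 * n / 4)) : ℕ) : ℝ)
        ≤ ((n ^ (min (D * A.card) (3 * n / 4)) : ℕ) : ℝ) := by
          exact_mod_cast Nat.choose_le_pow _ _
      _ ≤ (n : ℝ) ^ (D * A.card) := by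
          push_cast
          exact pow_le_pow_right₀ hn' (min_le_left _ _)
  have h3 : ∑ A : Finset V, y ^ A.card = (y + 1) ^ n := by
    have := Fintype.sum_pow_mul_eq_add_pow V y 1
    simpa using this
  have h4 : ∑ A ∈ Finset.univ.erase (∅ : Finset V), y ^ A.card = (y + 1) ^ n - 1 := by
    rw [← h3, ← Finset.add_sum_erase _ _ (Finset.mem_univ (∅ : Finset V))]
    simp
  have h5 : (y + 1) ^ n < 2 := by
    calc (y + 1) ^ n ≤ (Real.exp y) ^ n :=
          pow_le_pow_left₀ (by positivity) (Real.add_one_le_exp y) n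
      _ = Real.exp (n * y) := (Real.exp_nat_mul y n).symm
      _ ≤ Real.exp (1 / 2) := Real.exp_le_exp.2 hny
      _ < 2 := by
        have h6 : Real.exp (1 / 2) ^ 2 = Real.exp 1 := by
          rw [← Real.exp_nat_mul]; norm_num
        have := Real.exp_one_lt_d9
        nlinarith [Real.exp_pos (1 / 2)]
  calc _ ≤ ∑ A ∈ Finset.univ.erase (∅ : Finset V), y ^ A.card := by
        rw [h1]; exact Finset.sum_le_sum fun A _ => h2 A
    _ < 1 := by rw [h4]; linarith

end Potential

/-! ### The greedy construction of the expander -/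

/-- A graph of girth at least `g` on the edges `x — f (x, i)`, for `(x, i) ∈ P`, with controlled
degrees and small potential. -/
structure IsGreedy (k D g : ℕ) (P : Finset (V × Fin k)) (f : V × Fin k → V)
    (G : SimpleGraph V) : Prop where
  adj : ∀ e ∈ P, G.Adj e.1 (f e)
  girth : (g : ℕ∞) ≤ G.egirth
  deg_le : ∀ v, deg G v ≤ 32 * k + (P.filter fun e => e.1 = v).card
  sum_deg_le : ∑ v, deg G v ≤ 2 * P.card
  potential_lt : potential (6 / 7) (obstructions V D) f P < 1

/-- New endpoints are chosen among vertices of degree below `32 * k` and outside a ball around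
`a.1`. The total degree excludes at most n/16 vertices by degree, and the ball has at most n/16. The
ratio of 3n/4 to the remaining 7n/8 is the 6/7 in the potential. -/
theorem IsGreedy.exists_insert {k D g : ℕ} {P : Finset (V × Fin k)} {f : V × Fin k → V}
    (h : IsGreedy k D g P f G) (hn : 16 * (33 * k + 1) ^ g ≤ Fintype.card V)
    {a : V × Fin k} (ha : a ∉ P) :
    ∃ f' G', IsGreedy k D g (insert a P) f' G' := by
  classical
  set n := Fintype.card V with hndef
  have hk : 1 ≤ k := Nat.one_le_iff_ne_zero.2 fun hk => by subst hk; exact a.2.elim0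
  have hcardk : ∀ v, (P.filter fun e => e.1 = v).card ≤ k := by
    intro v
    calc (P.filter fun e => e.1 = v).card
        ≤ ((Finset.univ : Finset (Fin k)).image fun i => (v, i)).card := by
          refine Finset.card_le_card fun e he => ?_
          have := (Finset.mem_filter.1 he).2
          exact Finset.mem_image.2 ⟨e.2, Finset.mem_univ _, by rw [← this]⟩
      _ ≤ (Finset.univ : Finset (Fin k)).card := Finset.card_image_le
      _ = k := by simp
  have hdeg : ∀ v, deg G v ≤ 33 * k := fun v => by
    have h1 := h.deg_le v
    have h2 := hcardk v
    omega
  set H := Finset.univ.filter fun v => 32 * k ≤ deg G v with hH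
  have hHc : 16 * H.card ≤ n := by
    have h1 : H.card * (32 * k) ≤ ∑ v ∈ H, deg G v := by
      rw [← smul_eq_mul]
      exact Finset.card_nsmul_le_sum _ _ _ fun v hv => (Finset.mem_filter.1 hv).2
    have h2 : ∑ v ∈ H, deg G v ≤ ∑ v, deg G v :=
      Finset.sum_le_sum_of_subset (Finset.subset_univ _)
    have h3 : P.card ≤ n * k := by
      have := Finset.card_le_univ P
      simpa [hndef] using this
    have h4 : (16 * H.card) * (2 * k) ≤ n * (2 * k) := by
      have := h.sum_deg_le
      nlinarith
    exact Nat.le_of_mul_le_mul_right h4 (by omega)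
  set S := (H ∪ distBall G a.1 g)ᶜ with hS
  have hSc : 7 * n ≤ 8 * S.card := by
    have h1 := card_distBall_le hdeg a.1 g
    have h2 := Finset.card_union_le H (distBall G a.1 g)
    rw [hS, Finset.card_compl]
    omega
  have hn0 : 0 < n := Fintype.card_pos_iff.2 ⟨a.1⟩
  have hSne : S.Nonempty := Finset.card_pos.1 (by omega)
  obtain ⟨v, hvS, hv⟩ := exists_potential_update_le (f := f) (T := obstructions V D)
    (ρ := 6 / 7) (by norm_num) ha hSne (fun τ hτ => by
      simp only [obstructions, Finset.mem_filter, Finset.mem_powersetCard] at hτ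
      have h1 : τ.2.card ≤ 3 * n / 4 := by
        rw [hτ.2.2.2]; exact min_le_right _ _
      have h2 : 4 * τ.2.card ≤ 3 * n := by omega
      have h3 : (4 * τ.2.card : ℝ) ≤ 3 * n := by exact_mod_cast h2
      have h4 : (7 * n : ℝ) ≤ 8 * S.card := by exact_mod_cast hSc
      linarith)
  rw [hS, Finset.mem_compl, Finset.mem_union, not_or] at hvS
  have hwalk : ∀ p : G.Walk a.1 v, g ≤ p.length := by
    intro p
    by_contra! hlt
    exact hvS.2 (mem_distBall_of_walk p.reverse (by
      rw [SimpleGraph.Walk.length_reverse]; exact hlt.le))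
  have hva : a.1 ≠ v := by
    intro hav
    exact hvS.2 (mem_distBall_of_walk (SimpleGraph.Walk.nil.copy hav rfl) (by simp))
  have hvdeg : deg G v < 32 * k := by
    by_contra! hge
    exact hvS.1 (Finset.mem_filter.2 ⟨Finset.mem_univ _, hge⟩)
  refine ⟨Function.update f a v, G ⊔ SimpleGraph.edge a.1 v, ?_, ?_, ?_, ?_, ?_⟩
  · intro e he
    rw [SimpleGraph.sup_adj]
    by_cases hea : e = a
    · subst hea
      rw [Function.update_self]
      exact Or.inr ((SimpleGraph.edge_adj _ _ _ _).2 ⟨Or.inl ⟨rfl, rfl⟩, hva⟩)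
    · rw [Function.update_of_ne hea]
      exact Or.inl (h.adj e ((Finset.mem_insert.1 he).resolve_left hea))
  · exact le_egirth_sup_edge h.girth hwalk
  · intro u
    have h1 := deg_sup_edge_le (G := G) a.1 v u
    have h2 := h.deg_le u
    have h3 : (P.filter fun e => e.1 = u).card ≤ ((insert a P).filter fun e => e.1 = u).card :=
      Finset.card_le_card (Finset.filter_subset_filter _ (Finset.subset_insert _ _))
    by_cases hua : u = a.1
    · have huv : u ≠ v := fun h => hva (hua ▸ h)
      rw [if_pos hua, if_neg huv] at h1
      rw [Finset.filter_insert, if_pos hua.symm, Finset.card_insert_of_notMem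
        (fun hm => ha (Finset.mem_filter.1 hm).1)]
      omega
    · rw [if_neg hua] at h1
      by_cases huv : u = v
      · rw [if_pos huv] at h1
        rw [huv] at h1 ⊢
        omega
      · rw [if_neg huv] at h1
        omega
  · calc ∑ u, deg (G ⊔ SimpleGraph.edge a.1 v) u
        ≤ ∑ u, (deg G u + ((if u = a.1 then 1 else 0) + if u = v then 1 else 0)) :=
          Finset.sum_le_sum fun u _ => deg_sup_edge_le _ _ _
      _ = ∑ u, deg G u + 2 := by
          rw [Finset.sum_add_distrib, Finset.sum_add_distrib]
          simp
      _ ≤ 2 * (insert a P).card := by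
          rw [Finset.card_insert_of_notMem ha]
          have := h.sum_deg_le
          omega
  · exact lt_of_le_of_lt hv h.potential_lt

theorem exists_expands_le_egirth (k D g : ℕ) (hn : 16 * (33 * k + 1) ^ g ≤ Fintype.card V)
    (hk : 2 * (Fintype.card V : ℝ) ^ (D + 1) * (6 / 7) ^ k ≤ 1) :
    ∃ G : SimpleGraph V, Expands G D ∧ (g : ℕ∞) ≤ G.egirth := by
  set n := Fintype.card V with hndef
  have hn1 : 1 ≤ n := by
    have : 0 < 16 * (33 * k + 1) ^ g := by positivity
    omega
  have key : ∀ P : Finset (V × Fin k), ∃ f G, IsGreedy k D g P f G := by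
    intro P
    induction P using Finset.induction_on with
    | empty =>
      have hnb : ∀ v, deg (⊥ : SimpleGraph V) v = 0 := by
        intro v
        rw [deg, Finset.card_eq_zero, Finset.eq_empty_iff_forall_notMem]
        intro w hw
        obtain ⟨u, -, hu⟩ := mem_nbrs.1 hw
        exact hu
      exact ⟨fun e => e.1, ⊥, by simp, by simp, fun v => by simp [hnb], by simp [hnb],
        potential_empty_lt_one (by norm_num) hn1 hk⟩
    | insert a P ha ih =>
      obtain ⟨f, G, hG⟩ := ih
      exact hG.exists_insert hn ha
  obtain ⟨f, G, hG⟩ := key Finset.univ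
  refine ⟨G, fun A hA => ?_, hG.girth⟩
  by_contra! hcon
  have hle : (nbrs G A).card ≤ min (D * A.card) (3 * n / 4) := le_min hcon.1 (by omega)
  -- A small neighbourhood is padded to the exact size required in `obstructions`.
  obtain ⟨B, hAB, -, hB⟩ := Finset.exists_subsuperset_card_eq (Finset.subset_univ (nbrs G A)) hle
    ((min_le_right _ _).trans (by rw [Finset.card_univ]; omega))
  obtain ⟨e, heA, heB⟩ := exists_notMem_of_potential_lt_one (τ := (A, B)) (by norm_num)
    hG.potential_lt (by
      simp only [obstructions, Finset.mem_filter, Finset.mem_univ, true_and, Finset.mem_erase,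
        Finset.mem_powersetCard, and_true, Finset.subset_univ]
      exact ⟨hA.ne_empty, hB⟩)
  exact heB (hAB (mem_nbrs.2 ⟨e.1, heA, hG.adj e (Finset.mem_univ _)⟩))

/-- Expansion from two vertices at once bounds the distance between them. -/
theorem Expands.exists_walk_length_eq {D e : ℕ} (hG : Expands G D) (hD : 1 ≤ D)
    (he : Fintype.card V ≤ D ^ e) (u v : V) : ∃ p : G.Walk u v, p.length = 2 * e := by
  have key : ∀ (x : V) (j : ℕ), ∃ S : Finset V, (∀ y ∈ S, ∃ p : G.Walk x y, p.length = j) ∧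
      (D ^ j ≤ S.card ∨ 3 * Fintype.card V < 4 * S.card) := by
    intro x j
    induction j with
    | zero => exact ⟨{x}, fun y hy => by
        rw [Finset.mem_singleton] at hy
        subst hy
        exact ⟨.nil, rfl⟩, by simp⟩
    | succ j ih =>
      obtain ⟨S, hS, hcard⟩ := ih
      refine ⟨nbrs G S, fun y hy => ?_, ?_⟩
      · obtain ⟨z, hz, hzy⟩ := mem_nbrs.1 hy
        obtain ⟨p, hp⟩ := hS z hz
        exact ⟨p.concat hzy, by rw [SimpleGraph.Walk.length_concat, hp]⟩
      · have hne : S.Nonempty := by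
          rw [← Finset.card_pos]
          rcases hcard with h | h
          · exact lt_of_lt_of_le (by positivity) h
          · omega
        rcases hG S hne with h | h
        · rcases hcard with h' | h'
          · left
            rw [pow_succ, mul_comm]
            exact (Nat.mul_le_mul_left _ h').trans h.le
          · right
            nlinarith
        · exact Or.inr h
  obtain ⟨S, hS, hSc⟩ := key u e
  obtain ⟨T, hT, hTc⟩ := key v e
  have hn : 0 < Fintype.card V := Fintype.card_pos_iff.2 ⟨u⟩
  -- Each set of endpoints has more than half of the vertices.
  have hmeet : ¬ Disjoint S T := by
    intro hd
    have := Finset.card_le_univ (S ∪ T)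
    rw [Finset.card_union_of_disjoint hd] at this
    omega
  obtain ⟨w, hwS, hwT⟩ := Finset.not_disjoint_iff.1 hmeet
  obtain ⟨p, hp⟩ := hS w hwS
  obtain ⟨r, hr⟩ := hT w hwT
  exact ⟨p.append r.reverse, by
    rw [SimpleGraph.Walk.length_append, SimpleGraph.Walk.length_reverse, hp, hr]; ring⟩

end Greedy

/-! ### Class 0, existence of a cycle, and the parameters -/

section ClassZero

variable {V : Type*} [Fintype V] [DecidableEq V] {G : SimpleGraph V}

/-- Fewer than n pebbles can be placed singly off a root `r`; then no step is possible and `r` stays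
empty. As the defining set is nonempty, its infimum belongs to it. -/
theorem classZero_of_forall_solvable [Nonempty V]
    (h : ∀ C : V → ℕ, ∑ v, C v = Fintype.card V → Solvable G C) : ClassZero G := by
  refine le_antisymm (Nat.sInf_le h) ?_
  have hmem : pebblingNumber G ∈ {m : ℕ | ∀ C : V → ℕ, ∑ v, C v = m → Solvable G C} :=
    Nat.sInf_mem ⟨_, h⟩
  by_contra! hlt
  obtain ⟨r⟩ := ‹Nonempty V›
  have hle : pebblingNumber G ≤ (Finset.univ.erase r).card := by
    rw [Finset.card_erase_of_mem (Finset.mem_univ r), Finset.card_univ]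
    omega
  obtain ⟨S, hSr, hS⟩ := Finset.exists_subset_card_eq hle
  obtain ⟨E, hE, hEr⟩ := hmem (fun v => if v ∈ S then 1 else 0) (by simp [hS]) r
  rcases Relation.ReflTransGen.cases_head hE with rfl | ⟨E', ⟨u, v, -, hu, -⟩, -⟩
  · have : r ∉ S := fun h => Finset.ne_of_mem_erase (hSr h) rfl
    simp [this] at hEr
  · dsimp only at hu
    split_ifs at hu; omega

-- Expansion of singletons forbids leaves, whereas a nontrivial tree has one.
omit [DecidableEq V] in
theorem Expands.not_isAcyclic {D : ℕ} (hG : Expands G D) (hD : 2 ≤ D)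
    (hn : 4 * D ≤ Fintype.card V) (hconn : G.Connected) : ¬ G.IsAcyclic := by
  classical
  intro hac
  have : Nontrivial V := Fintype.one_lt_card_iff_nontrivial.1 (by omega)
  have hmin := SimpleGraph.IsTree.minDegree_eq_one_of_nontrivial ⟨hconn, hac⟩
  obtain ⟨v, hv⟩ := G.exists_minimal_degree_vertex
  have hnb : (nbrs G {v}).card = G.degree v := by
    rw [← SimpleGraph.card_neighborFinset_eq_degree]
    congr 1
    ext w
    simp [mem_nbrs]
  rcases hG {v} (Finset.singleton_nonempty v) with h | h
  · rw [Finset.card_singleton] at h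
    omega
  · omega

end ClassZero

/-- Since (6/7)^5 < 1/2, an exponent of 5(m + 1) beats 2 · 2^m. -/
theorem girth_parameter_bound {g n : ℕ} (hg : 2 ≤ g) (hn : n ≤ 2 ^ (1600 * g ^ 2)) :
    2 * (n : ℝ) ^ (2 ^ (160 * g) + 1) * (6 / 7) ^ (2 ^ (180 * g)) ≤ 1 := by
  set D := 2 ^ (160 * g) with hD
  set m := 1600 * g ^ 2 * (D + 1) with hm
  have hD1 : 1 ≤ D := Nat.one_le_two_pow
  have hk : 5 * (m + 1) ≤ 2 ^ (180 * g) := by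
    have hgg : g ^ 2 ≤ 2 ^ (2 * g) := by
      rw [mul_comm, pow_mul]
      exact Nat.pow_le_pow_left Nat.lt_two_pow_self.le 2
    calc 5 * (m + 1) ≤ 16384 * (g ^ 2 * D) := by rw [hm]; nlinarith
      _ ≤ 2 ^ 14 * (2 ^ (2 * g) * 2 ^ (160 * g)) := by
          refine Nat.mul_le_mul (by norm_num) (Nat.mul_le_mul hgg le_rfl)
      _ = 2 ^ (14 + (2 * g + 160 * g)) := by rw [pow_add, pow_add]
      _ ≤ 2 ^ (180 * g) := Nat.pow_le_pow_right (by norm_num) (by omega)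
  have h1 : (n : ℝ) ^ (D + 1) ≤ 2 ^ m := by
    have : (n : ℝ) ≤ 2 ^ (1600 * g ^ 2) := by exact_mod_cast hn
    calc (n : ℝ) ^ (D + 1) ≤ (2 ^ (1600 * g ^ 2)) ^ (D + 1) :=
          pow_le_pow_left₀ (by positivity) this _
      _ = 2 ^ m := by rw [← pow_mul]
  have h2 : ((6 / 7 : ℝ)) ^ (2 ^ (180 * g)) ≤ (1 / 2) ^ (m + 1) := by
    calc ((6 / 7 : ℝ)) ^ (2 ^ (180 * g)) ≤ (6 / 7) ^ (5 * (m + 1)) :=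
          pow_le_pow_of_le_one (by norm_num) (by norm_num) hk
      _ = ((6 / 7) ^ 5) ^ (m + 1) := pow_mul _ _ _
      _ ≤ (1 / 2) ^ (m + 1) := pow_le_pow_left₀ (by norm_num) (by norm_num) _
  calc 2 * (n : ℝ) ^ (D + 1) * (6 / 7) ^ (2 ^ (180 * g))
      ≤ 2 * 2 ^ m * (1 / 2) ^ (m + 1) := by gcongr
    _ = (2 * (1 / 2)) ^ (m + 1) := by rw [mul_pow, pow_succ 2 m]; ring
    _ = 1 := by norm_num

/-- With D = 2^(160g), D^(10g) = 2^(1600g²) ≥ n gives diameter at most 20g. Thus q = 2^(20g), J =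
80g + 1 ensures q^J > n, and the expansion needed is at most 2^(120g + 4) ≤ D. Degrees of order
2^(180g) leave room for girth g. -/
theorem exists_classZero_le_girth {g n : ℕ} (hg : 2 ≤ g) (hn : 2 ^ (1600 * (g - 1) ^ 2) ≤ n)
    (hn' : n ≤ 2 ^ (1600 * g ^ 2)) :
    ∃ G : SimpleGraph (Fin n), ClassZero G ∧ G.Connected ∧ g ≤ G.girth := by
  have hpow : ∀ {a b : ℕ}, a ≤ b → 2 ^ a ≤ 2 ^ b := fun h =>
    Nat.pow_le_pow_right (by norm_num) h
  have hsize : 16 * (33 * 2 ^ (180 * g) + 1) ^ g ≤ n := by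
    have h1 : 33 * 2 ^ (180 * g) + 1 ≤ 2 ^ (180 * g + 6) := by
      have : 1 ≤ 2 ^ (180 * g) := Nat.one_le_two_pow
      rw [pow_add]
      omega
    calc 16 * (33 * 2 ^ (180 * g) + 1) ^ g ≤ 2 ^ 4 * (2 ^ (180 * g + 6)) ^ g :=
          Nat.mul_le_mul (by norm_num) (Nat.pow_le_pow_left h1 g)
      _ = 2 ^ (4 + (180 * g + 6) * g) := by rw [← pow_mul, ← pow_add]
      _ ≤ 2 ^ (1600 * (g - 1) ^ 2) := hpow (by
          obtain ⟨h, rfl⟩ := Nat.exists_eq_add_of_le hg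
          rw [show 2 + h - 1 = h + 1 by omega]
          nlinarith)
      _ ≤ n := hn
  have hDn : 4 * 2 ^ (160 * g) ≤ n := by
    calc 4 * 2 ^ (160 * g) = 2 ^ (2 + 160 * g) := by rw [pow_add]; norm_num
      _ ≤ 2 ^ (1600 * (g - 1) ^ 2) := hpow (by
          obtain ⟨h, rfl⟩ := Nat.exists_eq_add_of_le hg
          rw [show 2 + h - 1 = h + 1 by omega]
          nlinarith)
      _ ≤ n := hn
  have hD2 : 2 ≤ 2 ^ (160 * g) := by
    calc 2 = 2 ^ 1 := rfl
      _ ≤ _ := hpow (by omega)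
  obtain ⟨G, hG, hgirth⟩ := exists_expands_le_egirth (V := Fin n) (2 ^ (180 * g))
    (2 ^ (160 * g)) g (by simpa using hsize) (by
      rw [Fintype.card_fin]; exact girth_parameter_bound hg hn')
  have hwalk := hG.exists_walk_length_eq (e := 10 * g) (by omega) (by
    rw [Fintype.card_fin, ← pow_mul]
    exact hn'.trans (hpow (by nlinarith)))
  have hne : Nonempty (Fin n) := ⟨⟨0, by omega⟩⟩
  have hconn : G.Connected := ⟨fun u v => (hwalk u v).elim fun p _ => ⟨p⟩⟩
  refine ⟨G, ?_, hconn, ?_⟩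
  · refine classZero_of_forall_solvable fun C hC =>
      solvable_of_expands (d := 20 * g) (J := 80 * g + 1) hG (fun u v => ?_) ?_ ?_ ?_ C hC
    · obtain ⟨p, hp⟩ := hwalk u v
      exact ⟨p, by omega⟩
    · rw [Fintype.card_fin, ← pow_mul]
      exact lt_of_le_of_lt hn' (Nat.pow_lt_pow_right (by norm_num) (by nlinarith))
    · have h1 : 2 ≤ 2 ^ (20 * g) := by
        calc 2 = 2 ^ 1 := rfl
          _ ≤ _ := hpow (by omega)
      have h2 : 2 ^ (20 * g) ≤ 2 ^ (20 * g) * 2 ^ (80 * g + 1) :=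
        Nat.le_mul_of_pos_right _ (by positivity)
      calc 2 * (2 ^ (20 * g) + 2) * (2 ^ (20 * g) + 2 ^ (20 * g) * 2 ^ (80 * g + 1))
          ≤ 2 * (2 * 2 ^ (20 * g)) * (2 * (2 ^ (20 * g) * 2 ^ (80 * g + 1))) :=
            Nat.mul_le_mul (by omega) (by omega)
        _ = 2 ^ (4 + 120 * g) := by ring
        _ ≤ 2 ^ (160 * g) := hpow (by omega)
    · rw [Fintype.card_fin]; exact hDn
  · have hcyc : ¬ G.IsAcyclic := hG.not_isAcyclic hD2 (by simpa using hDn) hconn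
    have htop : G.egirth ≠ ⊤ := SimpleGraph.egirth_eq_top.not.2 hcyc
    rw [SimpleGraph.girth]
    exact_mod_cast ENat.toNat_le_toNat hgirth htop

theorem girth_le_maxClassZeroGirth {n : ℕ} {G : SimpleGraph (Fin n)} (hG : ClassZero G) :
    G.girth ≤ maxClassZeroGirth n := by
  obtain ⟨b, hb⟩ := (Set.finite_range fun G : SimpleGraph (Fin n) => G.girth).bddAbove
  refine le_csSup ⟨b, ?_⟩ ⟨G, le_rfl, hG⟩
  rintro g ⟨H, hH, -⟩
  exact hH.trans (hb ⟨H, rfl⟩)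

theorem exists_girth_parameter : ∃ n₀ : ℕ, ∀ n, n₀ ≤ n →
    ∃ g, 2 ≤ g ∧ 2 ^ (1600 * (g - 1) ^ 2) ≤ n ∧ n ≤ 2 ^ (1600 * g ^ 2) := by
  classical
  obtain ⟨m, hm⟩ : ∃ m, m = 1600 := ⟨_, rfl⟩
  refine ⟨2 ^ m + 1, fun n hn => ?_⟩
  have hex : ∃ g, n ≤ 2 ^ (1600 * g ^ 2) :=
    ⟨n, Nat.lt_two_pow_self.le.trans (Nat.pow_le_pow_right (by norm_num)
      ((Nat.le_self_pow two_ne_zero n).trans (Nat.le_mul_of_pos_left _ (by norm_num))))⟩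
  have hle : ∀ g ≤ 1, ¬ n ≤ 2 ^ (1600 * g ^ 2) := by
    intro g hg
    rw [not_le]
    have h1 : g ^ 2 ≤ 1 := Nat.pow_le_one_iff (by norm_num) |>.2 hg
    exact (Nat.pow_le_pow_right (by norm_num) (by omega : 1600 * g ^ 2 ≤ m)).trans_lt hn
  have hg2 : 2 ≤ Nat.find hex := by
    by_contra! hlt
    exact hle _ (by omega) (Nat.find_spec hex)
  -- Minimality of the least `g` gives the lower bound on `n` at `g - 1`.
  exact ⟨Nat.find hex, hg2, (not_le.1 (Nat.find_min hex (by omega))).le, Nat.find_spec hex⟩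

end Pebbling

theorem theorem1 :
    (∃ (n₀ : ℕ) (c : ℝ), 0 < c ∧ ∀ n : ℕ, n₀ ≤ n →
      (∃ G : SimpleGraph (Fin n), Pebbling.ClassZero G ∧
        c * Real.sqrt (Real.logb 2 (n : ℝ)) ≤ (G.girth : ℝ)) ∧
      c * Real.sqrt (Real.logb 2 (n : ℝ)) ≤ (Pebbling.maxClassZeroGirth n : ℝ)) ∧
    ¬ ∃ C : ℕ, ∀ (n : ℕ) (G : SimpleGraph (Fin n)),
      G.Connected → C < G.girth → n < Pebbling.pebblingNumber G := by
  constructor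
  · obtain ⟨n₀, hn₀⟩ := Pebbling.exists_girth_parameter
    -- The constant is 1/√1600, from n ≤ 2^(1600g²).
    refine ⟨n₀, 1 / 40, by norm_num, fun n hn => ?_⟩
    obtain ⟨g, hg, h1, h2⟩ := hn₀ n hn
    obtain ⟨G, hG, -, hgirth⟩ := Pebbling.exists_classZero_le_girth hg h1 h2
    have hn0 : (0 : ℝ) < n := by
      have : 0 < n := lt_of_lt_of_le (by positivity) h1
      exact_mod_cast this
    have hlog : Real.logb 2 (n : ℝ) ≤ (40 * g) ^ 2 := by
      rw [Real.logb_le_iff_le_rpow (by norm_num) hn0]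
      calc (n : ℝ) ≤ (2 : ℝ) ^ (1600 * g ^ 2 : ℕ) := by exact_mod_cast h2
        _ = (2 : ℝ) ^ ((40 * g : ℝ) ^ 2) := by
            rw [← Real.rpow_natCast]
            congr 1
            push_cast
            ring
    have hle : 1 / 40 * Real.sqrt (Real.logb 2 (n : ℝ)) ≤ (G.girth : ℝ) := by
      have h3 : Real.sqrt (Real.logb 2 (n : ℝ)) ≤ 40 * g :=
        (Real.sqrt_le_left (by positivity)).2 hlog
      have h4 : (g : ℝ) ≤ G.girth := by exact_mod_cast hgirth
      linarith
    exact ⟨⟨G, hG, hle⟩, hle.trans (by exact_mod_cast Pebbling.girth_le_maxClassZeroGirth hG)⟩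
  · rintro ⟨C, hC⟩
    have hmono : 2 ^ (1600 * (C + 2 - 1) ^ 2) ≤ 2 ^ (1600 * (C + 2) ^ 2) :=
      Nat.pow_le_pow_right (by norm_num)
        (Nat.mul_le_mul_left _ (Nat.pow_le_pow_left (by omega) 2))
    obtain ⟨G, hG, hconn, hgirth⟩ := Pebbling.exists_classZero_le_girth (g := C + 2)
      (by omega) hmono le_rfl
    have h := hC _ G hconn (by omega)
    rw [hG, Fintype.card_fin] at h
    exact lt_irrefl _ h
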